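/- Work over $\mathbb{C}$ with the Zariski topology, and let $p\in\mathbb{C}^m$ denote parameters. Let $r\ge 0$, and for $b=1,\dots,r$ let there be given a polynomial system $f^b(x;p)$ in $x\in\mathbb{C}^{n_b}$, an irreducible algebraic set $A_b\subset V(f^b(x,p))\subset\mathbb{C}^{n_b}\times\mathbb{C}^m$, and a polynomial system $F^b_c(x,y,p)$ with auxiliary variables $y\in\mathbb{C}^{l_b}$, depending polynomially on constants $c\in\mathbb{C}^{k_b}$. For $a=(a_1,\dots,a_r)\in\mathbb{Z}_{\ge0}^r$ and constants $c=(c_{b,i})_{1\le b\le r,\,1\le i\le a_b}$, $c_{b,i}\in\mathbb{C}^{k_b}$, let $$\mathcal F_{a,c}=\bigl\{F^b_{c_{b,i}}(x_{b,i},y_{b,i},p)\ :\ 1\le b\le r,\ 1\le i\le a_b\bigr\}$$ be the stack of the fiber product systems $\mathcal F^1_{a_1},\dots,\mathcal F^r_{a_r}$ with common parameters $p$, let $\pi_a$ be the projection $(x,y,p)\mapsto p$, and let $V_A(\mathcal F_{a,c})$ be the set of points of $V(\mathcal F_{a,c})$ with $(x_{b,i},p)\in A_b$ for all $b,i$. For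 all $a$ and $c$ let $\Delta_{a,c}\subset V(\mathcal F_{a,c})$ be an algebraic set (the components to ignore), chosen consistently: if $a\le a'$ componentwise, and a point of $V_A(\mathcal F_{a',c'})$ becomes a point of $\Delta_{a,c}$ when, for each $b$, only the first $a_b$ of the $(x_{b,i},y_{b,i})$ and of the $c'_{b,i}$ are kept (the constants kept being $c$), then the point lies in $\Delta_{a',c'}$. Put $$D(a,c)=\dim\overline{\pi_a\bigl(V_A(\mathcal F_{a,c})\setminus\Delta_{a,c}\bigr)},$$ where the empty set has dimension $-\infty$. Then the dimension stabilizes: 1. For every choice of sequences of constants $(c_{b,i})_{i\ge1}$, $b=1,\dots,r$, there are $a_1,\dots,a_r\ge0$ such that $D(j,c|_j)=D(a,c|_a)$ for all $j\in\mathbb{Z}_{\ge0}^r$ with $j\ge a$ componentwise, where $c|_j$ consists of the $c_{b,i}$ with $i\le j_b$. 2. If moreover $\{(c,z): z\in\Delta_{a,c}\}$ is an algebraic set for every $a$, then $a_1,\dots,a_r$ can be chosen independently of the constants: there are $a\in\mathbb{Z}_{\ge0}^r$ and $d$ such that, for all $j\ge a$, $D(j,c)=d$ for generic constants $c$, that is,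 for all $c$ outside a proper algebraic subset of $\prod_b(\mathbb{C}^{k_b})^{j_b}$. -/

import Mathlib

open MvPolynomial

namespace FiberProduct

noncomputable section

/-! Algebraic geometry in affine space over the complex numbers. -/

/-- A Zariski closed subset of affine space `ℂ^σ`. -/
def IsAlgebraicSet {σ : Type} (X : Set (σ → ℂ)) : Prop :=
  ∃ I : Ideal (MvPolynomial σ ℂ), X = zeroLocus ℂ I

/-- An irreducible algebraic set: nonempty, and not covered by two algebraic sets unless one of
them already covers it. -/
def IsIrreducibleAlgebraicSet {σ : Type} (X : Set (σ → ℂ)) : Prop :=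
  IsAlgebraicSet X ∧ X.Nonempty ∧
    ∀ Y Z : Set (σ → ℂ), IsAlgebraicSet Y → IsAlgebraicSet Z → X ⊆ Y ∪ Z → X ⊆ Y ∨ X ⊆ Z

/-- The Zariski closure of a subset of `ℂ^σ`. -/
def zariskiClosure {σ : Type} (S : Set (σ → ℂ)) : Set (σ → ℂ) :=
  zeroLocus ℂ (vanishingIdeal ℂ S)

/-- The dimension of an algebraic set: the Krull dimension of its coordinate ring
(`⊥` for the empty set). -/
def algDim {σ : Type} (X : Set (σ → ℂ)) : WithBot ℕ∞ :=
  ringKrullDim (MvPolynomial σ ℂ ⧸ (vanishingIdeal ℂ X : Ideal (MvPolynomial σ ℂ)))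

/-- `P c` holds for generic `c ∈ ℂ^σ`: all exceptions lie in a proper algebraic subset. -/
def ForGeneric {σ : Type} (P : (σ → ℂ) → Prop) : Prop :=
  ∃ Z : Set (σ → ℂ), IsAlgebraicSet Z ∧ Z ≠ Set.univ ∧ ∀ c, c ∉ Z → P c

/-- The common zero set of a polynomial system. -/
def solutionSet {σ ι : Type} (f : ι → MvPolynomial σ ℂ) : Set (σ → ℂ) :=
  {z | ∀ e, eval z (f e) = 0}

/-- The data imposing one condition on the parameter space `ℂ^m`. -/
structure Condition (m : ℕ) where
  /-- number of variables `x` -/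
  n : ℕ
  /-- number of auxiliary variables `y` -/
  l : ℕ
  /-- number of constants `c` used for randomization and slicing -/
  k : ℕ
  /-- number of equations of `f` -/
  q : ℕ
  /-- number of equations of `F` -/
  N : ℕ
  /-- the parameterized system `f(x; p)` -/
  f : Fin q → MvPolynomial (Fin n ⊕ Fin m) ℂ
  /-- the set to which the points `(x, p)` are restricted -/
  A : Set (Fin n ⊕ Fin m → ℂ)
  A_irreducible : IsIrreducibleAlgebraicSet A
  A_subset : A ⊆ solutionSet f
  /-- the component system `F_c(x, y, p)`; the variables are `c`, `x`, `y`, `p` in this order -/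
  F : Fin N → MvPolynomial (Fin k ⊕ (Fin n ⊕ Fin l) ⊕ Fin m) ℂ

/-- The component system `F_c` for a choice of the constants, in the variables `x`, `y`, `p`. -/
def Condition.component {m : ℕ} (S : Condition m) (c : Fin S.k → ℂ) (e : Fin S.N) :
    MvPolynomial ((Fin S.n ⊕ Fin S.l) ⊕ Fin m) ℂ :=
  aeval (Sum.elim (fun κ => C (c κ)) X) (S.F e)

section Stacking

variable {m r : ℕ}

/-- The constants of the stacked system with `a b` component systems for condition `b`. -/
abbrev ConstIndex (S : Fin r → Condition m) (a : Fin r → ℕ) : Type :=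
  Σ b : Fin r, Fin (a b) × Fin (S b).k

/-- The variables `x_{b,i}`, `y_{b,i}` of the stacked system. -/
abbrev VarIndex (S : Fin r → Condition m) (a : Fin r → ℕ) : Type :=
  Σ b : Fin r, Fin (a b) × (Fin (S b).n ⊕ Fin (S b).l)

/-- The equations of the stacked system. -/
abbrev EqIndex (S : Fin r → Condition m) (a : Fin r → ℕ) : Type :=
  Σ b : Fin r, Fin (a b) × Fin (S b).N

/-- The affine space of all `(x, y, p)`. -/
abbrev TotalSpace (S : Fin r → Condition m) (a : Fin r → ℕ) : Type :=
  VarIndex S a ⊕ Fin m → ℂ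

/-- The variables of the `i`-th copy of the component system of condition `b`: own copies of `x`
and `y`, and the common parameters `p`. -/
def copyVar (S : Fin r → Condition m) (a : Fin r → ℕ) (b : Fin r) (i : Fin (a b)) :
    (Fin (S b).n ⊕ Fin (S b).l) ⊕ Fin m → VarIndex S a ⊕ Fin m :=
  Sum.map (fun s => ⟨b, (i, s)⟩) id

/-- The stacked fiber product system, whose blocks are
`F^b_{c_{b,1}}(x_{b,1}, y_{b,1}, p), …, F^b_{c_{b,a_b}}(x_{b,a_b}, y_{b,a_b}, p)`. -/
def stackedSystem (S : Fin r → Condition m) (a : Fin r → ℕ) (c : ConstIndex S a → ℂ) :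
    EqIndex S a → MvPolynomial (VarIndex S a ⊕ Fin m) ℂ :=
  fun e => rename (copyVar S a e.1 e.2.1)
    ((S e.1).component (fun κ => c ⟨e.1, (e.2.1, κ)⟩) e.2.2)

/-- The point `(x_{b,i}, p)` of a point of the total space. -/
def basePoint (S : Fin r → Condition m) (a : Fin r → ℕ) (z : TotalSpace S a)
    (b : Fin r) (i : Fin (a b)) : Fin (S b).n ⊕ Fin m → ℂ :=
  Sum.elim (fun s => z (Sum.inl ⟨b, (i, Sum.inl s)⟩)) (fun s => z (Sum.inr s))

/-- The solutions of the stacked system all of whose points `(x_{b,i}, p)` lie in `A_b`. -/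
def restrictedSolutionSet (S : Fin r → Condition m) (a : Fin r → ℕ) (c : ConstIndex S a → ℂ) :
    Set (TotalSpace S a) :=
  {z | z ∈ solutionSet (stackedSystem S a c) ∧ ∀ b i, basePoint S a z b i ∈ (S b).A}

/-- The projection of the total space onto the parameters. -/
def paramProj (S : Fin r → Condition m) (a : Fin r → ℕ) (z : TotalSpace S a) : Fin m → ℂ :=
  fun s => z (Sum.inr s)

/-- Sets to ignore: one set for all counts `a` and all values of the constants. -/
abbrev IgnoredSets (S : Fin r → Condition m) : Type :=
  ∀ a : Fin r → ℕ, (ConstIndex S a → ℂ) → Set (TotalSpace S a)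

/-- Keeping only the constants of the first `a b` component systems of each condition `b`. -/
def truncConst (S : Fin r → Condition m) {a a' : Fin r → ℕ} (h : a ≤ a')
    (c : ConstIndex S a' → ℂ) : ConstIndex S a → ℂ :=
  fun v => c ⟨v.1, (Fin.castLE (h v.1) v.2.1, v.2.2)⟩

/-- Keeping only the variables of the first `a b` component systems of each condition `b`. -/
def truncPoint (S : Fin r → Condition m) {a a' : Fin r → ℕ} (h : a ≤ a')
    (z : TotalSpace S a') : TotalSpace S a :=
  fun v => z (Sum.map (fun w => ⟨w.1, (Fin.castLE (h w.1) w.2.1, w.2.2)⟩) id v)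

/-- The ignored sets are algebraic subsets of the solution sets, and they are removed
consistently: what is ignored for `a` remains ignored after imposing further components. -/
structure IgnoredSets.IsConsistent {S : Fin r → Condition m} (Δ : IgnoredSets S) : Prop where
  isAlgebraicSet : ∀ a c, IsAlgebraicSet (Δ a c)
  subset : ∀ a c, Δ a c ⊆ solutionSet (stackedSystem S a c)
  mono : ∀ (a a' : Fin r → ℕ) (h : a ≤ a') (c : ConstIndex S a' → ℂ),
    ∀ z ∈ restrictedSolutionSet S a' c,
      truncPoint S h z ∈ Δ a (truncConst S h c) → z ∈ Δ a' c

/-- The ignored sets depend algebraically on the constants. -/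
def IgnoredSets.IsAlgebraicFamily {S : Fin r → Condition m} (Δ : IgnoredSets S) : Prop :=
  ∀ a, IsAlgebraicSet {w : ConstIndex S a ⊕ (VarIndex S a ⊕ Fin m) → ℂ |
    (fun v => w (Sum.inr v)) ∈ Δ a (fun κ => w (Sum.inl κ))}

/-- The dimension of the closure of the image, in the parameter space, of the restricted solution
set without the ignored set. -/
def imageDim (S : Fin r → Condition m) (Δ : IgnoredSets S) (a : Fin r → ℕ)
    (c : ConstIndex S a → ℂ) : WithBot ℕ∞ :=
  algDim (zariskiClosure (paramProj S a '' (restrictedSolutionSet S a c \ Δ a c)))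

/-- The constants used by the stacked system `a`, out of a sequence of constants for each
condition. -/
def constsOf (S : Fin r → Condition m) (c : ∀ b : Fin r, ℕ → Fin (S b).k → ℂ) (a : Fin r → ℕ) :
    ConstIndex S a → ℂ :=
  fun v => c v.1 (v.2.1 : ℕ) v.2.2

end Stacking

end

end FiberProduct

/-! ### Dimension of affine algebras -/

/-- Lying over and going up lift chains of primes from `R` to `S`; by incomparability, strict chains
in `S` contract to strict chains. -/
theorem ringKrullDim_eq_of_injective_of_isIntegral {R S : Type*} [CommRing R] [CommRing S]
    [Algebra R S] [Algebra.IsIntegral R S] (h : Function.Injective (algebraMap R S)) :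
    ringKrullDim R = ringKrullDim S := by
  have := (faithfulSMul_iff_algebraMap_injective R S).mpr h
  apply le_antisymm
  · refine iSup_le fun p => ?_
    obtain ⟨Q, hQ, hQp⟩ := (Ideal.nonempty_primesOver (P := p.head.asIdeal) (S := S))
    have := hQp
    obtain ⟨l, hl, -⟩ := Ideal.exists_ltSeries_of_hasGoingUp (S := S) p Q
    rw [← hl]
    exact le_iSup (fun q : LTSeries (PrimeSpectrum S) => ((q.length : ℕ∞) : WithBot ℕ∞)) l
  · refine Order.krullDim_le_of_strictMono (PrimeSpectrum.comap (algebraMap R S)) ?_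
    intro p q hpq
    exact Ideal.IsIntegral.comap_lt_comap hpq

/-- The Krull dimension of an affine domain is its transcendence degree. -/
theorem exists_isTranscendenceBasis_ringKrullDim_eq (k A : Type*) [Field k] [CommRing A]
    [IsDomain A] [Algebra k A] [Algebra.FiniteType k A] :
    ∃ (s : ℕ) (x : Fin s → A), ringKrullDim A = s ∧ IsTranscendenceBasis k x := by
  -- Noether normalization: the images of the variables are the transcendence basis.
  obtain ⟨s, g, hg, hint⟩ := exists_integral_inj_algHom_of_fg k A
  have hx : aeval (fun i => g (X i)) = g := by ext; simp
  have hind : AlgebraicIndependent k (fun i => g (X i)) := by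
    rw [AlgebraicIndependent, hx]; exact hg
  refine ⟨s, fun i => g (X i), ?_, ?_⟩
  · let _ : Algebra (MvPolynomial (Fin s) k) A := g.toRingHom.toAlgebra
    have : Algebra.IsIntegral (MvPolynomial (Fin s) k) A := ⟨hint⟩
    rw [← ringKrullDim_eq_of_injective_of_isIntegral (R := MvPolynomial (Fin s) k) hg]
    simp
  · rw [isTranscendenceBasis_iff_algebraicIndependent_isAlgebraic]
    refine ⟨hind, ?_⟩
    have hr : Algebra.adjoin k (Set.range fun i => g (X i)) = g.range := by
      rw [Algebra.adjoin_range_eq_range_aeval, hx]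
    rw [hr]
    have : Algebra.IsIntegral g.range A := by
      refine ⟨fun a => ?_⟩
      obtain ⟨p, hp, hpa⟩ := hint a
      refine ⟨p.map g.rangeRestrict.toRingHom, hp.map _, ?_⟩
      rw [Polynomial.eval₂_map]
      exact hpa
    infer_instance

/-- The smallest prime of a long chain serves as `Q`. This reduces dimension to domains, where
transcendence bases are available. -/
theorem exists_isPrime_le_ringKrullDim_quotient {R : Type*} [CommRing R] (I : Ideal R) (d : ℕ)
    (h : (d : WithBot ℕ∞) ≤ ringKrullDim (R ⧸ I)) :
    ∃ Q : Ideal R, Q.IsPrime ∧ I ≤ Q ∧ (d : WithBot ℕ∞) ≤ ringKrullDim (R ⧸ Q) := by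
  obtain ⟨l, rfl⟩ := Order.le_krullDim_iff.mp h
  refine ⟨l.head.asIdeal.comap (Ideal.Quotient.mk I), inferInstance, fun a ha => ?_, ?_⟩
  · rw [Ideal.mem_comap, Ideal.Quotient.eq_zero_iff_mem.mpr ha]
    exact Ideal.zero_mem _
  · rw [ringKrullDim_quotient]
    refine Order.le_krullDim_iff.mpr ⟨⟨l.length, fun i => ⟨PrimeSpectrum.comap
      (Ideal.Quotient.mk I) (l i), ?_⟩, fun i => ?_⟩, rfl⟩
    · exact fun a ha => (LTSeries.head_le l i : l.head.asIdeal ≤ (l i).asIdeal) ha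
    · have hi : (l i.castSucc).asIdeal < (l i.succ).asIdeal := l.step i
      change (l i.castSucc).asIdeal.comap (Ideal.Quotient.mk I) <
        (l i.succ).asIdeal.comap (Ideal.Quotient.mk I)
      refine lt_of_le_not_ge (Ideal.comap_mono hi.le) fun hle => hi.not_ge fun a ha => ?_
      obtain ⟨a, rfl⟩ := Ideal.Quotient.mk_surjective a
      exact hle ha

theorem algebraicIndependent_mk_X_iff {σ ι k : Type*} [Field k] (I : Ideal (MvPolynomial σ k))
    (v : ι → σ) :
    AlgebraicIndependent k (fun i => Ideal.Quotient.mk I (X (v i))) ↔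
      ∀ f : MvPolynomial ι k, rename v f ∈ I → f = 0 := by
  rw [algebraicIndependent_iff]
  have (f : MvPolynomial ι k) : aeval (fun i => Ideal.Quotient.mk I (X (v i))) f =
      Ideal.Quotient.mk I (rename v f) := by
    change _ = ((Ideal.Quotient.mkₐ k I).comp (rename v)) f
    congr 1
    ext; simp
  simp only [this, Ideal.Quotient.eq_zero_iff_mem]

theorem exists_set_isTranscendenceBasis_of_adjoin_range_eq_top {σ k A : Type*} [Field k]
    [CommRing A] [IsDomain A] [Algebra k A] (y : σ → A) (hy : Algebra.adjoin k (Set.range y) = ⊤) :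
    ∃ u : Set σ, IsTranscendenceBasis k (fun i : u => y i) := by
  have : Algebra.IsAlgebraic (Algebra.adjoin k (Set.range y)) A := by
    rw [hy]
    exact ⟨fun a => isAlgebraic_algebraMap (⟨a, trivial⟩ : (⊤ : Subalgebra k A))⟩
  obtain ⟨t, hts, ht⟩ := exists_isTranscendenceBasis_subset (R := k) (Set.range y)
  obtain ⟨u, -, hu⟩ := (Set.surjOn_iff_exists_bijOn_subset (s := Set.univ) (f := y) (t := t)).mp
    (fun a ha => by obtain ⟨i, rfl⟩ := hts ha; exact ⟨i, trivial, rfl⟩)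
  exact ⟨u, ht.comp_equiv hu.equiv⟩

theorem adjoin_range_mk_X_eq_top {σ k : Type*} [Field k] (Q : Ideal (MvPolynomial σ k)) :
    Algebra.adjoin k (Set.range fun i => Ideal.Quotient.mk Q (X i)) = ⊤ := by
  rw [Algebra.adjoin_range_eq_range_aeval]
  have : aeval (fun i => Ideal.Quotient.mk Q (X i)) = Ideal.Quotient.mkₐ k Q := by ext; simp
  rw [this, AlgHom.range_eq_top]
  exact Ideal.Quotient.mkₐ_surjective k Q

/-- The dimension of an affine algebra is the largest number of variables without relations. -/
theorem natCast_le_ringKrullDim_quotient_iff {σ k : Type*} [Finite σ] [Field k]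
    (I : Ideal (MvPolynomial σ k)) (d : ℕ) :
    (d : WithBot ℕ∞) ≤ ringKrullDim (MvPolynomial σ k ⧸ I) ↔
      ∃ s : Finset σ, s.card = d ∧
        ∀ f : MvPolynomial s k, rename Subtype.val f ∈ I → f = 0 := by
  have key {Q : Ideal (MvPolynomial σ k)} [Q.IsPrime] {t : ℕ} {x : Fin t → MvPolynomial σ k ⧸ Q} (hx : IsTranscendenceBasis k x) :
      Algebra.trdeg k (MvPolynomial σ k ⧸ Q) = t := by
    simpa using hx.lift_cardinalMk_eq_trdeg.symm
  constructor
  · intro h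
    obtain ⟨Q, hQ, hIQ, hdim⟩ := exists_isPrime_le_ringKrullDim_quotient I d h
    obtain ⟨t, x, ht, hx⟩ := exists_isTranscendenceBasis_ringKrullDim_eq k (MvPolynomial σ k ⧸ Q)
    rw [ht] at hdim
    have hdim : d ≤ t := by exact_mod_cast hdim
    obtain ⟨u, hu⟩ := exists_set_isTranscendenceBasis_of_adjoin_range_eq_top _
      (adjoin_range_mk_X_eq_top Q)
    have huc : u.ncard = t := by
      have h1 := hu.lift_cardinalMk_eq_trdeg
      rw [key hx, Cardinal.lift_natCast, Cardinal.lift_eq_nat_iff] at h1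
      rw [← Nat.card_coe_set_eq, Nat.card, h1, Cardinal.toNat_natCast]
    obtain ⟨v, hvu, hv⟩ := Set.exists_subset_card_eq (hdim.trans huc.ge)
    refine ⟨(Set.toFinite v).toFinset, by rw [← Set.ncard_eq_toFinset_card, hv], fun f hf => ?_⟩
    have hvi := hu.1.comp (fun i : (Set.toFinite v).toFinset => ⟨i.1, hvu ((Set.toFinite v).mem_toFinset.mp i.2)⟩)
      fun a b hab => by ext; simpa using hab
    exact (algebraicIndependent_mk_X_iff Q _).mp hvi f (hIQ hf)
  · rintro ⟨s, rfl, hs⟩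
    -- The nonzero polynomials in the variables of `s` form a multiplicative set missing `I`, so
    -- some prime above `I` avoids it and keeps these variables independent.
    let M : Submonoid (MvPolynomial σ k) :=
      (nonZeroDivisors (MvPolynomial s k)).map (rename Subtype.val : MvPolynomial s k →ₐ[k] _)
    obtain ⟨P, hP, hIP, hPM⟩ := Ideal.exists_le_prime_disjoint I M (by
      rw [Set.disjoint_left]
      rintro _ ha ⟨f, hf, rfl⟩
      exact nonZeroDivisors.ne_zero hf (hs f ha))
    refine le_trans ?_ (ringKrullDim_le_of_surjective (Ideal.Quotient.factor hIP)
      (Ideal.Quotient.factor_surjective hIP))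
    obtain ⟨t, x, ht, hx⟩ := exists_isTranscendenceBasis_ringKrullDim_eq k (MvPolynomial σ k ⧸ P)
    rw [ht]
    have hi : AlgebraicIndependent k (fun i : s => Ideal.Quotient.mk P (X i.1)) := by
      rw [algebraicIndependent_mk_X_iff]
      intro f hf
      by_contra hne
      exact Set.disjoint_left.mp hPM hf ⟨f, mem_nonZeroDivisors_of_ne_zero hne, rfl⟩
    have h1 := hi.lift_cardinalMk_le_trdeg
    rw [key hx] at h1
    have : s.card ≤ t := by simpa using h1
    exact_mod_cast this

/-! ### Constructible sets and a generic dichotomy -/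

/-- The property passes to complements by symmetry, and to unions because in a domain two nonempty
basic opens meet in the nonempty `basicOpen (g * g')`. -/
theorem exists_basicOpen_subset_or_disjoint {R : Type*} [CommRing R] [IsDomain R]
    {T : Set (PrimeSpectrum R)} (hT : Topology.IsConstructible T) :
    ∃ g : R, g ≠ 0 ∧ ((PrimeSpectrum.basicOpen g : Set (PrimeSpectrum R)) ⊆ T ∨
      Disjoint (PrimeSpectrum.basicOpen g : Set (PrimeSpectrum R)) T) := by
  induction hT using Topology.IsConstructible.empty_union_induction with
  | open_retrocompact U hU hUc =>
    rcases U.eq_empty_or_nonempty with rfl | ⟨x, hx⟩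
    · exact ⟨1, one_ne_zero, Or.inr (by simp)⟩
    · obtain ⟨_, ⟨g, rfl⟩, hxg, hgU⟩ :=
        PrimeSpectrum.isTopologicalBasis_basic_opens.exists_subset_of_mem_open hx hU
      refine ⟨g, ?_, Or.inl hgU⟩
      rintro rfl
      simp at hxg
  | union s hs t ht hs' ht' =>
    obtain ⟨g, hg, hgs | hgs⟩ := hs'
    · exact ⟨g, hg, Or.inl (hgs.trans Set.subset_union_left)⟩
    · obtain ⟨g', hg', hgt | hgt⟩ := ht'
      · exact ⟨g', hg', Or.inl (hgt.trans Set.subset_union_right)⟩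
      · refine ⟨g * g', mul_ne_zero hg hg', Or.inr ?_⟩
        rw [PrimeSpectrum.basicOpen_mul, Set.disjoint_union_right]
        exact ⟨hgs.mono_left Set.inter_subset_left, hgt.mono_left Set.inter_subset_right⟩
  | compl s hs hs' =>
    obtain ⟨g, hg, hgs | hgs⟩ := hs'
    · exact ⟨g, hg, Or.inr (Set.disjoint_compl_right_iff_subset.mpr hgs)⟩
    · exact ⟨g, hg, Or.inl hgs.subset_compl_right⟩

theorem isConstructible_zeroLocus {R : Type*} [CommRing R] [IsNoetherianRing R] (s : Set R) :
    Topology.IsConstructible (PrimeSpectrum.zeroLocus s) := by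
  rw [← Topology.isConstructible_compl]
  exact (TopologicalSpace.NoetherianSpace.isCompact _).isConstructible
    (PrimeSpectrum.isClosed_zeroLocus s).isOpen_compl

theorem exists_point_notMem_of_isPrime {σ : Type*} [Finite σ] (Q M : Ideal (MvPolynomial σ ℂ))
    [Q.IsPrime] (h : ¬ M ≤ Q) : ∃ w ∈ zeroLocus ℂ Q, w ∉ zeroLocus ℂ M := by
  by_contra! hc
  apply h
  rw [← IsPrime.vanishingIdeal_zeroLocus (K := ℂ) Q, ← le_zeroLocus_iff_le_vanishingIdeal]
  exact hc

namespace FiberProduct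

/-- Either almost all or almost no points are coordinate projections of points of `X \ Y`. -/
theorem exists_ne_zero_forall_mem_image_or {α τ : Type} [Finite α] [Finite τ] (v : α → τ)
    {X Y : Set (τ → ℂ)} (hX : IsAlgebraicSet X) (hY : IsAlgebraicSet Y) :
    ∃ g : MvPolynomial α ℂ, g ≠ 0 ∧
      ((∀ a, eval a g ≠ 0 → ∃ w ∈ X \ Y, w ∘ v = a) ∨
        ∀ w ∈ X \ Y, eval (w ∘ v) g = 0) := by
  obtain ⟨I, rfl⟩ := hX
  obtain ⟨J, rfl⟩ := hY
  let φ : MvPolynomial α ℂ →+* MvPolynomial τ ℂ := (rename v : _ →ₐ[ℂ] _).toRingHom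
  have hφ : φ.FinitePresentation := by
    apply RingHom.FinitePresentation.of_finiteType.mp
    have h1 : (φ.comp C).FiniteType := by
      rw [show φ.comp C = C by ext; simp [φ], ← algebraMap_eq, RingHom.finiteType_algebraMap]
      infer_instance
    exact RingHom.FiniteType.of_comp_finiteType h1
  -- Chevalley's theorem, applied to the image of `V(I) \ V(J)`.
  obtain ⟨g, hg, h⟩ := exists_basicOpen_subset_or_disjoint
    (PrimeSpectrum.isConstructible_comap_image hφ ((isConstructible_zeroLocus (I : Set _)).sdiff
      (isConstructible_zeroLocus (J : Set _))))
  refine ⟨g, hg, h.imp (fun h a ha => ?_) fun h w hw => ?_⟩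
  · have : pointToPoint (k := ℂ) a ∈ PrimeSpectrum.basicOpen g := by
      simpa [pointToPoint, mem_vanishingIdeal_singleton_iff] using ha
    obtain ⟨Q, ⟨hIQ, hJQ⟩, hQ⟩ := h this
    -- The prime `Q` over `a` need not be maximal; the Nullstellensatz supplies a closed point of
    -- `V(Q)` outside `V(J)`. It lies over `a` because `X i - a i` pulls back into `Q`.
    obtain ⟨w, hwQ, hwJ⟩ := exists_point_notMem_of_isPrime Q.asIdeal J hJQ
    refine ⟨w, ⟨zeroLocus_anti_mono hIQ hwQ, hwJ⟩, ?_⟩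
    ext i
    have h1 : (X i - C (a i) : MvPolynomial α ℂ) ∈ (PrimeSpectrum.comap φ Q).asIdeal := by
      rw [hQ]
      simp [pointToPoint]
    have h2 := hwQ _ h1
    simpa [φ, sub_eq_zero] using h2
  · by_contra hne
    refine (Set.disjoint_left.mp h :
      ∀ ⦃a⦄, _ → _) (?_ : PrimeSpectrum.comap φ (pointToPoint (k := ℂ) w) ∈ _)
      ⟨_, ⟨?_, ?_⟩, rfl⟩
    · simpa [φ, pointToPoint, mem_vanishingIdeal_singleton_iff, eval_rename, aeval_rename] using hne
    · exact pointToPoint_zeroLocus_le I ⟨w, hw.1, rfl⟩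
    · refine fun hJ => hw.2 fun f hf => ?_
      exact (mem_vanishingIdeal_singleton_iff w f).mp (hJ hf)

end FiberProduct

/-! ### Preliminaries on polynomials, algebraic sets and closures -/

theorem WithBot.eq_of_forall_natCast_le_iff {x y : WithBot ℕ∞}
    (h : ∀ d : ℕ, (d : WithBot ℕ∞) ≤ x ↔ (d : WithBot ℕ∞) ≤ y) : x = y := by
  have key {x y : WithBot ℕ∞} (h : ∀ d : ℕ, (d : WithBot ℕ∞) ≤ x → (d : WithBot ℕ∞) ≤ y) :
      x ≤ y := by
    cases x with
    | bot => exact bot_le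
    | coe x =>
      cases y with
      -- The case `d = 0` separates `⊥` from the values in `ℕ∞`.
      | bot => exact absurd (h 0 (by simp)) (by simp)
      | coe y =>
        refine WithBot.coe_le_coe.mpr (ENat.forall_natCast_le_iff_le.mp fun d hd => ?_)
        exact WithBot.coe_le_coe.mp (h d (WithBot.coe_le_coe.mpr hd))
  exact le_antisymm (key fun d => (h d).mp) (key fun d => (h d).mpr)

theorem MvPolynomial.exists_eval_ne_zero {σ : Type*} {g : MvPolynomial σ ℂ} (hg : g ≠ 0) :
    ∃ a, eval a g ≠ 0 := by
  by_contra! h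
  exact hg (MvPolynomial.funext fun a => by simpa using h a)

theorem MvPolynomial.eval_aeval_elim_C_X {α β : Type*} (c : α → ℂ) (u : β → ℂ)
    (f : MvPolynomial (α ⊕ β) ℂ) :
    eval u (aeval (Sum.elim (fun i => C (c i)) X) f : MvPolynomial β ℂ) =
      eval (Sum.elim c u) f := by
  rw [← aeval_eq_eval, ← aeval_eq_eval]
  change ((aeval u).comp (aeval _)) f = _
  congr 1
  ext i
  cases i <;> simp

namespace FiberProduct

section AlgebraicSets

variable {σ τ : Type}

theorem isAlgebraicSet_setOf_eval_eq_zero {ι : Type*} (f : ι → MvPolynomial σ ℂ) :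
    IsAlgebraicSet {z | ∀ i, eval z (f i) = 0} := by
  refine ⟨Ideal.span (Set.range f), ?_⟩
  rw [zeroLocus_span]
  ext z
  simp [aeval_eq_eval]

theorem IsAlgebraicSet.iInter {ι : Type*} {X : ι → Set (σ → ℂ)} (h : ∀ i, IsAlgebraicSet (X i)) :
    IsAlgebraicSet (⋂ i, X i) := by
  choose I hI using h
  refine ⟨⨆ i, I i, ?_⟩
  rw [(zeroLocus_vanishingIdeal_galoisConnection (k := ℂ) (K := ℂ)).l_iSup]
  simp only [hI]
  rfl

theorem IsAlgebraicSet.inter {X Y : Set (σ → ℂ)} (hX : IsAlgebraicSet X) (hY : IsAlgebraicSet Y) :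
    IsAlgebraicSet (X ∩ Y) := by
  rw [Set.inter_eq_iInter]
  exact .iInter fun b => by cases b <;> assumption

theorem IsAlgebraicSet.preimage_comp {X : Set (σ → ℂ)} (hX : IsAlgebraicSet X) (v : σ → τ) :
    IsAlgebraicSet {w : τ → ℂ | w ∘ v ∈ X} := by
  obtain ⟨I, rfl⟩ := hX
  convert isAlgebraicSet_setOf_eval_eq_zero (fun f : I => rename v f.1) using 1
  ext w
  simp [mem_zeroLocus_iff, eval_rename, aeval_eq_eval]

theorem algDim_zariskiClosure (T : Set (σ → ℂ)) :
    algDim (zariskiClosure T) = ringKrullDim (MvPolynomial σ ℂ ⧸ vanishingIdeal ℂ T) := by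
  have : vanishingIdeal ℂ (zariskiClosure T) = vanishingIdeal ℂ T :=
    (zeroLocus_vanishingIdeal_galoisConnection (k := ℂ) (K := ℂ)).u_l_u_eq_u T
  rw [algDim, this]

theorem algDim_zariskiClosure_mono {T U : Set (σ → ℂ)} (h : T ⊆ U) :
    algDim (zariskiClosure T) ≤ algDim (zariskiClosure U) := by
  rw [algDim_zariskiClosure, algDim_zariskiClosure]
  exact ringKrullDim_le_of_surjective _
    (Ideal.Quotient.factor_surjective (vanishingIdeal_anti_mono h))

theorem forGeneric_of_ne_zero {P : (σ → ℂ) → Prop} {g : MvPolynomial σ ℂ} (hg : g ≠ 0)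
    (h : ∀ c, eval c g ≠ 0 → P c) : ForGeneric P := by
  refine ⟨{z | ∀ _ : Unit, eval z g = 0}, isAlgebraicSet_setOf_eval_eq_zero _, ?_, ?_⟩
  · obtain ⟨a, ha⟩ := exists_eval_ne_zero hg
    exact fun hu => ha ((hu ▸ Set.mem_univ a : a ∈ {z | ∀ _ : Unit, eval z g = 0}) ())
  · exact fun c hc => h c fun h0 => hc fun _ => h0

end AlgebraicSets

/-! ### Generic dimension in families -/

section Fibers

variable {κ ν μ : Type} [Finite κ] [Finite ν] [Finite μ]

/-- The projection to the last coordinates of the fiber over `c` of a family of sets. -/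
def fiberImage (W : Set (κ ⊕ (ν ⊕ μ) → ℂ)) (c : κ → ℂ) : Set (μ → ℂ) :=
  {p | ∃ v, Sum.elim c (Sum.elim v p) ∈ W}

/-- The dichotomy for the projection to `(c, p_s)` does not depend on `c`, so whether the
coordinates in `s` satisfy a relation is the same for all good `c`. -/
theorem exists_ne_zero_forall_no_relation_or {X Y : Set (κ ⊕ (ν ⊕ μ) → ℂ)} (hX : IsAlgebraicSet X)
    (hY : IsAlgebraicSet Y) (s : Finset μ) :
    ∃ g : MvPolynomial κ ℂ, g ≠ 0 ∧ ∀ c c', eval c g ≠ 0 → eval c' g ≠ 0 →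
      (∀ f : MvPolynomial s ℂ, rename Subtype.val f ∈ vanishingIdeal ℂ (fiberImage (X \ Y) c) →
        f = 0) →
      ∀ f : MvPolynomial s ℂ, rename Subtype.val f ∈ vanishingIdeal ℂ (fiberImage (X \ Y) c') →
        f = 0 := by
  obtain ⟨g, hg, h⟩ := exists_ne_zero_forall_mem_image_or
    (Sum.map id fun i : s => Sum.inr i.1) hX hY
  obtain ⟨a, ha⟩ := exists_eval_ne_zero hg
  let gc (c : κ → ℂ) : MvPolynomial s ℂ := aeval (Sum.elim (fun i => C (c i)) MvPolynomial.X) g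
  have hgc (c : κ → ℂ) (u : s → ℂ) : eval u (gc c) = eval (Sum.elim c u) g :=
    eval_aeval_elim_C_X c u g
  -- Freezing the `s`-coordinates where `g` is nonzero: `g'(c) ≠ 0` forces `g(c, ·) ≠ 0`.
  let g' : MvPolynomial κ ℂ := aeval (Sum.elim MvPolynomial.X fun i => C (a (Sum.inr i))) g
  have hg' (c : κ → ℂ) : eval c g' = eval (Sum.elim c (a ∘ Sum.inr)) g := by
    rw [← aeval_eq_eval, ← aeval_eq_eval]
    change ((aeval c).comp (aeval _)) g = _
    congr 1
    ext i
    cases i <;> simp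
  have hgc0 (c : κ → ℂ) (hc : eval c g' ≠ 0) : gc c ≠ 0 := by
    intro h0
    rw [hg', ← hgc, h0, map_zero] at hc
    exact hc rfl
  refine ⟨g', ?_, ?_⟩
  · intro h0
    have := hg' (a ∘ Sum.inl)
    rw [h0, map_zero, Sum.elim_comp_inl_inr] at this
    exact ha this.symm
  · intro c c' hc hc' hcf f hf
    rcases h with h | h
    -- Wherever `g(c', ·)` is nonzero the point lifts to the fiber, so `f` vanishes there.
    · have : f * gc c' = 0 := by
        refine MvPolynomial.funext fun u => ?_
        rw [map_mul, map_zero, hgc]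
        by_cases hu : eval (Sum.elim c' u) g = 0
        · rw [hu, mul_zero]
        · obtain ⟨w, hw, hwu⟩ := h _ hu
          have hwe : Sum.elim c' (Sum.elim (fun i => w (Sum.inr (Sum.inl i)))
              fun i => w (Sum.inr (Sum.inr i))) = w := by
            ext (i | i | i)
            · exact (congrFun hwu (Sum.inl i)).symm
            · rfl
            · rfl
          have h1 := hf (fun i => w (Sum.inr (Sum.inr i))) ⟨_, hwe.symm ▸ hw⟩
          have h2 : (fun i => w (Sum.inr (Sum.inr i))) ∘ Subtype.val = u := by
            ext i
            exact congrFun hwu (Sum.inr i)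
          rw [aeval_eq_eval, eval_rename, h2] at h1
          rw [h1, zero_mul]
      exact (mul_eq_zero.mp this).resolve_right (hgc0 c' hc')
    -- Here `g(c, ·)` is itself a nonzero relation on the fiber over `c`.
    · refine absurd (hcf (gc c) ?_) (hgc0 c hc)
      rintro p ⟨v, hv⟩
      rw [aeval_eq_eval, eval_rename, hgc]
      convert h _ hv using 3
      ext (i | i) <;> rfl

theorem exists_ne_zero_forall_algDim_fiberImage_eq {X Y : Set (κ ⊕ (ν ⊕ μ) → ℂ)}
    (hX : IsAlgebraicSet X) (hY : IsAlgebraicSet Y) :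
    ∃ (d : WithBot ℕ∞) (g : MvPolynomial κ ℂ), g ≠ 0 ∧
      ∀ c, eval c g ≠ 0 → algDim (zariskiClosure (fiberImage (X \ Y) c)) = d := by
  choose g hg h using exists_ne_zero_forall_no_relation_or hX hY
  have := Fintype.ofFinite (Finset μ)
  have hprod : ∏ s, g s ≠ 0 := Finset.prod_ne_zero_iff.mpr fun s _ => hg s
  obtain ⟨a, ha⟩ := exists_eval_ne_zero hprod
  refine ⟨algDim (zariskiClosure (fiberImage (X \ Y) a)), ∏ s, g s, hprod, fun c hc => ?_⟩
  rw [map_prod, Finset.prod_ne_zero_iff] at ha hc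
  refine WithBot.eq_of_forall_natCast_le_iff fun d => ?_
  simp only [algDim_zariskiClosure, natCast_le_ringKrullDim_quotient_iff]
  refine exists_congr fun s => and_congr_right fun _ => ⟨?_, ?_⟩
  · exact h s c a (hc s (Finset.mem_univ s)) (ha s (Finset.mem_univ s))
  · exact h s a c (ha s (Finset.mem_univ s)) (hc s (Finset.mem_univ s))

end Fibers

/-! ### Stacked systems: monotonicity and generic constancy -/

section Stacking

variable {m r : ℕ} (S : Fin r → Condition m) (Δ : IgnoredSets S)

theorem eval_stackedSystem (a : Fin r → ℕ) (c : ConstIndex S a → ℂ) (z : TotalSpace S a)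
    (e : EqIndex S a) :
    eval z (stackedSystem S a c e) =
      eval (Sum.elim (fun i => c ⟨e.1, (e.2.1, i)⟩) (z ∘ copyVar S a e.1 e.2.1))
        ((S e.1).F e.2.2) := by
  rw [stackedSystem, eval_rename, Condition.component, eval_aeval_elim_C_X]

theorem truncPoint_mem_restrictedSolutionSet {a a' : Fin r → ℕ} (h : a ≤ a')
    {c : ConstIndex S a' → ℂ} {z : TotalSpace S a'} (hz : z ∈ restrictedSolutionSet S a' c) :
    truncPoint S h z ∈ restrictedSolutionSet S a (truncConst S h c) := by
  refine ⟨fun e => ?_, fun b i => hz.2 b (Fin.castLE (h b) i)⟩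
  have := hz.1 ⟨e.1, (Fin.castLE (h e.1) e.2.1, e.2.2)⟩
  rw [eval_stackedSystem] at this ⊢
  have hz' : z ∘ copyVar S a' e.1 (Fin.castLE (h e.1) e.2.1) =
      truncPoint S h z ∘ copyVar S a e.1 e.2.1 := by
    ext (i | i) <;> rfl
  rw [← hz']
  exact this

variable {S Δ}

theorem imageDim_le_of_le (hΔ : Δ.IsConsistent) {a a' : Fin r → ℕ} (h : a ≤ a')
    (c : ConstIndex S a' → ℂ) : imageDim S Δ a' c ≤ imageDim S Δ a (truncConst S h c) := by
  refine algDim_zariskiClosure_mono ?_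
  rintro _ ⟨z, hz, rfl⟩
  exact ⟨truncPoint S h z, ⟨truncPoint_mem_restrictedSolutionSet S h hz.1,
    fun hd => hz.2 (hΔ.mono a a' h c z hz.1 hd)⟩, rfl⟩

variable (S) in
-- The systems are polynomial in the constants as well, so the constants can be treated as further
-- coordinates.
theorem isAlgebraicSet_restrictedSolutionSet_family (a : Fin r → ℕ) :
    IsAlgebraicSet {w : ConstIndex S a ⊕ (VarIndex S a ⊕ Fin m) → ℂ |
      w ∘ Sum.inr ∈ restrictedSolutionSet S a (w ∘ Sum.inl)} := by
  have h1 := isAlgebraicSet_setOf_eval_eq_zero fun e : EqIndex S a =>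
    rename (Sum.elim (fun i => Sum.inl ⟨e.1, (e.2.1, i)⟩) (Sum.inr ∘ copyVar S a e.1 e.2.1) :
      _ → ConstIndex S a ⊕ (VarIndex S a ⊕ Fin m)) ((S e.1).F e.2.2)
  have h2 (b : Fin r) (i : Fin (a b)) := (S b).A_irreducible.1.preimage_comp
    (Sum.elim (fun s => Sum.inr (Sum.inl ⟨b, (i, Sum.inl s)⟩)) (fun s => Sum.inr (Sum.inr s)) :
      _ → ConstIndex S a ⊕ (VarIndex S a ⊕ Fin m))
  convert h1.inter (.iInter fun b => .iInter fun i => h2 b i) using 1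
  ext w
  simp only [restrictedSolutionSet, solutionSet, Set.mem_ofPred_eq, Set.mem_inter_iff,
    Set.mem_iInter, eval_stackedSystem, eval_rename, Sum.comp_elim]
  rfl

theorem exists_ne_zero_forall_imageDim_eq (hΔ : Δ.IsAlgebraicFamily) (a : Fin r → ℕ) :
    ∃ (d : WithBot ℕ∞) (g : MvPolynomial (ConstIndex S a) ℂ), g ≠ 0 ∧
      ∀ c, eval c g ≠ 0 → imageDim S Δ a c = d := by
  obtain ⟨d, g, hg, h⟩ := exists_ne_zero_forall_algDim_fiberImage_eq
    (isAlgebraicSet_restrictedSolutionSet_family S a) (hΔ a)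
  refine ⟨d, g, hg, fun c hc => ?_⟩
  rw [← h c hc, imageDim]
  congr 2
  ext p
  constructor
  · rintro ⟨z, hz, rfl⟩
    refine ⟨fun v => z (Sum.inl v), ?_⟩
    have : Sum.elim (fun v => z (Sum.inl v)) (paramProj S a z) = z := by
      ext (i | i) <;> rfl
    rw [this]
    exact hz
  · rintro ⟨v, hv⟩
    exact ⟨Sum.elim v p, hv, rfl⟩

end Stacking

end FiberProduct

/-! ### Stabilization -/

theorem corollary2 {m r : ℕ} (S : Fin r → FiberProduct.Condition m)
    (Δ : FiberProduct.IgnoredSets S) (hΔ : Δ.IsConsistent) :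
    (∀ c : (b : Fin r) → ℕ → Fin (S b).k → ℂ,
      ∃ a : Fin r → ℕ, ∀ j : Fin r → ℕ, a ≤ j →
        FiberProduct.imageDim S Δ j (FiberProduct.constsOf S c j) =
          FiberProduct.imageDim S Δ a (FiberProduct.constsOf S c a)) ∧
    (Δ.IsAlgebraicFamily →
      ∃ (a : Fin r → ℕ) (d : WithBot ℕ∞), ∀ j : Fin r → ℕ, a ≤ j →
        FiberProduct.ForGeneric fun c : FiberProduct.ConstIndex S j → ℂ =>
          FiberProduct.imageDim S Δ j c = d) := by
  have stab (D : (Fin r → ℕ) → WithBot ℕ∞) (hD : Antitone D) : ∃ a, ∀ j, a ≤ j → D j = D a := by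
    obtain ⟨_, ⟨a, rfl⟩, ha⟩ := wellFounded_lt.has_min (Set.range D) (Set.range_nonempty D)
    exact ⟨a, fun j hj => le_antisymm (hD hj) (not_lt.mp (ha _ ⟨j, rfl⟩))⟩
  constructor
  -- Truncating `constsOf S c a'` yields `constsOf S c a` by definition.
  · exact fun c => stab _ fun a a' h => FiberProduct.imageDim_le_of_le hΔ h _
  · intro hfam
    choose d g hg h using FiberProduct.exists_ne_zero_forall_imageDim_eq hfam
    obtain ⟨a, ha⟩ := stab d fun a a' hle => by
      let v : FiberProduct.ConstIndex S a → FiberProduct.ConstIndex S a' :=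
        fun v => ⟨v.1, (Fin.castLE (hle v.1) v.2.1, v.2.2)⟩
      have hv : Function.Injective v := by
        rintro ⟨b, i, s⟩ ⟨b', i', s'⟩ hvv
        obtain ⟨rfl, hvv⟩ := Sigma.mk.inj_iff.mp hvv
        simpa using hvv
      -- To compare `d a'` with `d a`, take `c` generic for `a'` whose truncation `c ∘ v` is generic
      -- for `a`; injectivity of `v` keeps the renamed `g a` nonzero.
      obtain ⟨c, hc⟩ := MvPolynomial.exists_eval_ne_zero
        (mul_ne_zero (hg a') ((map_ne_zero_iff _ (MvPolynomial.rename_injective v hv)).mpr (hg a)))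
      rw [map_mul, MvPolynomial.eval_rename] at hc
      rw [← h a' c (left_ne_zero_of_mul hc), ← h a (c ∘ v) (right_ne_zero_of_mul hc)]
      exact FiberProduct.imageDim_le_of_le hΔ hle c
    exact ⟨a, d a, fun j hj => FiberProduct.forGeneric_of_ne_zero (hg j) fun c hc =>
      (h j c hc).trans (ha j hj)⟩
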